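/- Let $M$ be a smooth manifold of dimension $n\ge 3$ with a conformal structure of signature $(p,q)$, $p+q=n$, and let $\mathcal T$ be its standard tractor bundle. In a scale $g$ of the conformal class, with Levi-Civita connection $\nabla$ and Schouten tensor $P_{ab}$, tractors are triples $(\sigma,\mu^a,\rho)$; the tractor metric is $\langle(\sigma,\mu,\rho),(\tau,\nu,\pi)\rangle=\mu_a\nu^a+\sigma\pi+\rho\tau$, and the tractor connection is $$\nabla_a(\sigma,\mu^b,\rho)=(\nabla_a\sigma-\mu_a,\ \nabla_a\mu^b+\delta_a{}^b\rho+P_a{}^b\sigma,\ \nabla_a\rho-P_{ac}\mu^c).$$ Let $\Gamma$ be a smooth curve parametrized by $t$ in an open interval, with tangent vector $U^a$ and derived vectors $U^{(i)}=(U^c\nabla_c)^iU$. For an integer $r\ge 0$ the curve is $r$-null if everywhere along it $U,\dots,U^{(r-1)}$ are linearly independent and null and $U^{(r)}$ is not null ($r=0$: space- or time-like curves). For such a curve put $u=\sqrt{|U^{(r)}_cU^{(r)c}|}$, $\mathbf T=(0,0,u^{-1})$, and let $\mathbf U=\mathbf T'$, $\mathbf U'$, $\mathbf U''$, … be the successive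 tractor derivatives of $\mathbf T$ along the curve. Put $\epsilon=\langle\mathbf U^{(r)},\mathbf U^{(r)}\rangle$ and $\alpha=\langle\mathbf U^{(r+1)},\mathbf U^{(r+1)}\rangle$, and let $\Delta_m$ be the Gram determinant of the first $m$ tractors of the sequence $\mathbf T,\mathbf U,\mathbf U',\dots$. All of these depend on the parameter; a parameter of the curve belongs to the projective family if $\alpha\equiv0$ with respect to it. (1) Suppose that the conformal structure is positive definite, that $\Gamma$ is regular (so $r=0$), and that $\Phi=\langle\mathbf U'',\mathbf U''\rangle-\langle\mathbf U',\mathbf U'\rangle^2=-\Delta_4$ vanishes nowhere on $\Gamma$ (in particular this holds for a generic curve, i.e. one with all $\Delta_4,\dots,\Delta_{n+2}$ nowhere zero). Let $s$ be a conformal arc-length parameter, $ds=\Phi^{1/4}dt$, and let $K_1=\langle\mathbf U_1',\mathbf U_2\rangle$ be the first conformal curvature, computed with respect to $s$, where $\mathbf U_0=\mathbf T$, $\mathbf U_1=\mathbf U$, $\mathbf U_2=-\mathbf U'-\tfrac12\langle\mathbf U',\mathbf U'\rangle\mathbf T$ are the first tractors of the tractor Frenet frame. Then $s$ belongs to the projective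 family of parameters, i.e. $\langle\mathbf U',\mathbf U'\rangle\equiv0$ with respect to $s$, if and only if $K_1\equiv0$. (2) Suppose that the signature is arbitrary, that $\Gamma$ is $r$-null, and that $\Delta_{2r+4}$ vanishes nowhere on $\Gamma$. Let $s$ be a conformal pseudo-arc-length parameter, $ds=|\Delta_{2r+4}|^{1/(2r+4)}dt$, and let $K_1=-\tfrac12\epsilon\alpha$ be the first conformal curvature, computed with respect to $s$. Then $s$ belongs to the projective family of parameters of $\Gamma$ if and only if $K_1\equiv0$. -/

import Mathlib

open scoped Manifold ContDiff

noncomputable section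

namespace ConformalCurves

/-! ### Pseudo-Riemannian metrics and conformal structures -/

/-- Coordinate vector field `∂ᵢ` of the chart `φ`, at the point with coordinates `x`. -/
def coordVec {n : ℕ} {M : Type*} [TopologicalSpace M]
    [ChartedSpace (EuclideanSpace ℝ (Fin n)) M]
    (φ : OpenPartialHomeomorph M (EuclideanSpace ℝ (Fin n)))
    (x : EuclideanSpace ℝ (Fin n)) (i : Fin n) : TangentSpace (𝓡 n) (φ.symm x) :=
  mfderiv (𝓡 n) (𝓡 n) φ.symm x (EuclideanSpace.single i (1 : ℝ))

/-- A smooth pseudo-Riemannian metric of signature `(p, q)` on an `n`-dimensional manifold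
(`n = p + q` is forced by the signature condition as soon as `M` is nonempty). -/
structure PseudoMetric (n p q : ℕ) (M : Type*) [TopologicalSpace M]
    [ChartedSpace (EuclideanSpace ℝ (Fin n)) M] where
  /-- the bilinear form on each tangent space -/
  form : ∀ x : M, LinearMap.BilinForm ℝ (TangentSpace (𝓡 n) x)
  symm : ∀ x v w, form x v w = form x w v
  signature : ∀ x : M, ∃ b : Module.Basis (Fin p ⊕ Fin q) ℝ (TangentSpace (𝓡 n) x),
    ∀ i j, form x (b i) (b j) = if i = j then Sum.elim (fun _ => 1) (fun _ => -1) i else 0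
  /-- smoothness: the components in every chart of the atlas are smooth -/
  smooth : ∀ φ ∈ atlas (EuclideanSpace ℝ (Fin n)) M, ∀ i j : Fin n,
    ContDiffOn ℝ ∞
      (fun x => form (φ.symm x) (coordVec φ x i) (coordVec φ x j)) φ.target

/-- A conformal structure of signature `(p, q)`: a class of pseudo-Riemannian metrics of that
signature, consisting of all positive smooth multiples of any one of them. A metric of the class
is (equivalent to) a choice of conformal scale. -/
structure ConformalStructure (n p q : ℕ) (M : Type*) [TopologicalSpace M]
    [ChartedSpace (EuclideanSpace ℝ (Fin n)) M] where
  scales : Set (PseudoMetric n p q M)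
  nonempty : scales.Nonempty
  mem_iff : ∀ g ∈ scales, ∀ h : PseudoMetric n p q M, h ∈ scales ↔
    ∃ f : M → ℝ, ContMDiff (𝓡 n) 𝓘(ℝ, ℝ) ∞ f ∧ (∀ x, 0 < f x) ∧
      ∀ x v w, h.form x v w = f x * g.form x v w

/-! ### Levi-Civita connection and Schouten tensor in a chart -/

section Tensors

variable {n p q : ℕ} {M : Type*} [TopologicalSpace M]
  [ChartedSpace (EuclideanSpace ℝ (Fin n)) M]
  (g : PseudoMetric n p q M) (φ : OpenPartialHomeomorph M (EuclideanSpace ℝ (Fin n)))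

/-- Partial derivative `∂ᵢ f`. -/
def pd (i : Fin n) (f : EuclideanSpace ℝ (Fin n) → ℝ) (x : EuclideanSpace ℝ (Fin n)) : ℝ :=
  fderiv ℝ f x (EuclideanSpace.single i (1 : ℝ))

/-- The matrix `g_{ij}` of the metric in the chart `φ`. -/
def gMat (x : EuclideanSpace ℝ (Fin n)) : Matrix (Fin n) (Fin n) ℝ :=
  Matrix.of fun i j => g.form (φ.symm x) (coordVec φ x i) (coordVec φ x j)

/-- Christoffel symbols `Γ^k_{ij} = ½ g^{kl} (∂ᵢ g_{jl} + ∂ⱼ g_{il} - ∂ₗ g_{ij})`. -/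
def christoffel (k i j : Fin n) (x : EuclideanSpace ℝ (Fin n)) : ℝ :=
  (1 / 2) * ∑ l, (gMat g φ x)⁻¹ k l *
    (pd i (fun y => gMat g φ y j l) x + pd j (fun y => gMat g φ y i l) x
      - pd l (fun y => gMat g φ y i j) x)

/-- Ricci tensor
`R_{ij} = ∂ₖ Γ^k_{ij} - ∂ⱼ Γ^k_{ik} + Γ^k_{kl} Γ^l_{ij} - Γ^k_{jl} Γ^l_{ik}`
(positive on round spheres). -/
def ricci (i j : Fin n) (x : EuclideanSpace ℝ (Fin n)) : ℝ :=
  ∑ k, (pd k (christoffel g φ k i j) x - pd j (christoffel g φ k i k) x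
    + ∑ l, (christoffel g φ k k l x * christoffel g φ l i j x
      - christoffel g φ k j l x * christoffel g φ l i k x))

/-- Scalar curvature. -/
def scalarCurv (x : EuclideanSpace ℝ (Fin n)) : ℝ :=
  ∑ i, ∑ j, (gMat g φ x)⁻¹ i j * ricci g φ i j x

/-- Schouten tensor `P_{ab} = (R_{ab} - Sc g_{ab} / (2 (n - 1))) / (n - 2)`, for `n ≥ 3`. -/
def schouten (x : EuclideanSpace ℝ (Fin n)) : Matrix (Fin n) (Fin n) ℝ :=
  Matrix.of fun i j => ((n : ℝ) - 2)⁻¹ *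
    (ricci g φ i j x - scalarCurv g φ x / (2 * ((n : ℝ) - 1)) * gMat g φ x i j)

end Tensors

/-! ### Tractor calculus along a curve

In a scale `g`, the standard tractor bundle is `𝓔[1] ⊕ 𝓔^a[-1] ⊕ 𝓔[-1]`; the densities are
trivialised by the parallel scale, and tangent vectors are written in components of a chart `φ`. -/

/-- Components `(σ, μ^a, ρ)` of a standard tractor. -/
abbrev Tractor (n : ℕ) : Type := ℝ × (Fin n → ℝ) × ℝ

section Along

variable {n p q : ℕ} {M : Type*} [TopologicalSpace M]
  [ChartedSpace (EuclideanSpace ℝ (Fin n)) M]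
  (g : PseudoMetric n p q M) (φ : OpenPartialHomeomorph M (EuclideanSpace ℝ (Fin n)))
  (γ : ℝ → M)

/-- The metric at the point `γ t`, on vectors given by components in `φ`. -/
def gAt (t : ℝ) (v w : Fin n → ℝ) : ℝ := v ⬝ᵥ (gMat g φ (φ (γ t))).mulVec w

/-- The tangent vector `U^a` of the parametrized curve. -/
def tangent (t : ℝ) : Fin n → ℝ := fun i => deriv (fun τ => φ (γ τ) i) t

/-- Covariant derivative `U^c ∇_c μ^a` along the curve. -/
def covD (μ : ℝ → Fin n → ℝ) (t : ℝ) : Fin n → ℝ := fun k =>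
  deriv (fun τ => μ τ k) t +
    ∑ i, ∑ j, christoffel g φ k i j (φ (γ t)) * tangent φ γ t i * μ t j

/-- The derived vectors `U^{(i)}`, with `U^{(0)} = U`. -/
def derivedVec : ℕ → ℝ → Fin n → ℝ
  | 0 => tangent φ γ
  | i + 1 => covD g φ γ (derivedVec i)

/-- The standard tractor metric `⟨(σ,μ,ρ),(τ,ν,π)⟩ = μ_a ν^a + σ π + ρ τ` at `γ t`. -/
def tractorMetric (t : ℝ) (V W : Tractor n) : ℝ :=
  gAt g φ γ t V.2.1 W.2.1 + V.1 * W.2.2 + V.2.2 * W.1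

/-- The standard tractor connection along the curve:
`U^a ∇_a (σ, μ^b, ρ) = (σ' - μ_a U^a, μ'^b + ρ U^b + σ P_a^b U^a, ρ' - P_{ac} U^a μ^c)`. -/
def tractorD (V : ℝ → Tractor n) (t : ℝ) : Tractor n :=
  (deriv (fun τ => (V τ).1) t - gAt g φ γ t (V t).2.1 (tangent φ γ t),
   covD g φ γ (fun τ => (V τ).2.1) t + (V t).2.2 • tangent φ γ t
     + (V t).1 • ((gMat g φ (φ (γ t)))⁻¹ * (schouten g φ (φ (γ t))).transpose).mulVec
         (tangent φ γ t),
   deriv (fun τ => (V τ).2.2) t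
     - tangent φ γ t ⬝ᵥ (schouten g φ (φ (γ t))).mulVec (V t).2.1)

/-- The density `u = √|U^{(r)}_c U^{(r)c}|`. -/
def density (r : ℕ) (t : ℝ) : ℝ :=
  √|gAt g φ γ t (derivedVec g φ γ r t) (derivedVec g φ γ r t)|

/-- The derived tractors of an `r`-null curve (`r = 0`: space- or time-like curve):
`tractor r 0 = 𝐓 = (0, 0, u⁻¹)`, and `tractor r (i + 1) = 𝐔^{(i)}` is the `(i+1)`-st tractor
derivative of `𝐓` along the curve. -/
def tractor (r : ℕ) : ℕ → ℝ → Tractor n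
  | 0 => fun t => (0, 0, (density g φ γ r t)⁻¹)
  | k + 1 => tractorD g φ γ (tractor r k)

end Along

/-! ### Invariants of parametrized curves

All quantities at the parameter value `t` are read off in the preferred chart at `γ t`. -/

section Invariants

variable {n p q : ℕ} {M : Type*} [TopologicalSpace M]
  [ChartedSpace (EuclideanSpace ℝ (Fin n)) M]
  (g : PseudoMetric n p q M) (γ : ℝ → M)

/-- `⟨∇^i 𝐓, ∇^j 𝐓⟩` at `t`; so `⟨𝐔^{(i)}, 𝐔^{(j)}⟩` is `gram r (i + 1) (j + 1)`. -/
def gram (r i j : ℕ) (t : ℝ) : ℝ :=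
  let φ := chartAt (EuclideanSpace ℝ (Fin n)) (γ t)
  tractorMetric g φ γ t (tractor g φ γ r i t) (tractor g φ γ r j t)

/-- `ε = ⟨𝐔^{(r)}, 𝐔^{(r)}⟩`. -/
def eps (r : ℕ) (t : ℝ) : ℝ := gram g γ r (r + 1) (r + 1) t

/-- `α = ⟨𝐔^{(r+1)}, 𝐔^{(r+1)}⟩`. -/
def alpha (r : ℕ) (t : ℝ) : ℝ := gram g γ r (r + 2) (r + 2) t

/-- `β = ⟨𝐔^{(r+2)}, 𝐔^{(r+2)}⟩`. -/
def beta (r : ℕ) (t : ℝ) : ℝ := gram g γ r (r + 3) (r + 3) t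

/-- `Δ_m`, the Gram determinant of the first `m` tractors of `𝐓, 𝐔, 𝐔', …`. -/
def gramDet (r m : ℕ) (t : ℝ) : ℝ :=
  (Matrix.of fun i j : Fin m => gram g γ r i j t).det

/-- `Φ = ⟨𝐔'', 𝐔''⟩ - ⟨𝐔', 𝐔'⟩²` of a curve in positive definite signature. -/
def Phi (t : ℝ) : ℝ := beta g γ 0 t - alpha g γ 0 t ^ 2

/-- First conformal curvature in positive definite signature, for a curve parametrized by
conformal arc-length: the Frenet coefficient `K₁ = ⟨𝐔₁', 𝐔₂⟩`, where the tractor Frenet frame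
starts with `𝐔₀ = 𝐓`, `𝐔₁ = 𝐔`, `𝐔₂ = -𝐔' - ½ ⟨𝐔', 𝐔'⟩ 𝐓`. -/
def frenetK1 (t : ℝ) : ℝ :=
  let φ := chartAt (EuclideanSpace ℝ (Fin n)) (γ t)
  let U₀ : ℝ → Tractor n := tractor g φ γ 0 0
  let U₁ : ℝ → Tractor n := tractor g φ γ 0 1
  let U₂ : ℝ → Tractor n := fun τ => -tractorD g φ γ U₁ τ -
    ((1 / 2) * tractorMetric g φ γ τ (tractorD g φ γ U₁ τ) (tractorD g φ γ U₁ τ)) • U₀ τ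
  tractorMetric g φ γ t (tractorD g φ γ U₁ t) (U₂ t)

/-- First conformal curvature `K₁ = -½ ε α` of an `r`-null curve parametrized by conformal
pseudo-arc-length. -/
def nullK1 (r : ℕ) (t : ℝ) : ℝ := -(1 / 2) * eps g γ r t * alpha g γ r t

/-- `r`-null curves: `U, …, U^{(r-1)}` are linearly independent and null, `U^{(r)}` is not null.
The conditions are tensorial, hence the same in every chart. -/
def IsRNull (r : ℕ) (I : Set ℝ) : Prop :=
  ∀ t ∈ I, ∀ φ ∈ atlas (EuclideanSpace ℝ (Fin n)) M, γ t ∈ φ.source →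
    LinearIndependent ℝ (fun i : Fin r => derivedVec g φ γ i t) ∧
    (∀ i < r, gAt g φ γ t (derivedVec g φ γ i t) (derivedVec g φ γ i t) = 0) ∧
    gAt g φ γ t (derivedVec g φ γ r t) (derivedVec g φ γ r t) ≠ 0

/-- `τ` is a (smooth, regular) parameter on a curve that is parametrized by the interval `I`. -/
def IsParameter (I : Set ℝ) (τ : ℝ → ℝ) : Prop :=
  ContDiffOn ℝ ∞ τ I ∧ ∀ t ∈ I, deriv τ t ≠ 0

/-- The curve `γ : I → M` parametrized by `τ`, i.e. `γ ∘ τ⁻¹ : τ(I) → M`. -/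
def reparam {M : Type*} (γ : ℝ → M) (I : Set ℝ) (τ : ℝ → ℝ) : ℝ → M :=
  γ ∘ Function.invFunOn τ I

/-- `τ` belongs to the projective family of parameters of the `r`-null curve `γ : I → M`:
with respect to `τ`, `⟨𝐔^{(r+1)}, 𝐔^{(r+1)}⟩ = 0` along the curve. -/
def IsProjectiveParameter (r : ℕ) (I : Set ℝ) (τ : ℝ → ℝ) : Prop :=
  IsParameter I τ ∧ ∀ t ∈ I, alpha g (reparam γ I τ) r (τ t) = 0

/-- Conformal arc-length in positive definite signature: `ds = Φ^{1/4} dt`. -/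
def IsArcLength (I : Set ℝ) (s : ℝ → ℝ) : Prop :=
  IsParameter I s ∧ ∀ t ∈ I, deriv s t = Phi g γ t ^ (1 / 4 : ℝ)

/-- Conformal pseudo-arc-length of an `r`-null curve: `ds = |Δ_{2r+4}|^{1/(2r+4)} dt`. -/
def IsPseudoArcLength (r : ℕ) (I : Set ℝ) (s : ℝ → ℝ) : Prop :=
  IsParameter I s ∧
    ∀ t ∈ I, deriv s t = |gramDet g γ r (2 * r + 4) t| ^ (1 / (2 * (r : ℝ) + 4))

end Invariants

end ConformalCurves

end

open scoped Manifold ContDiff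
open ConformalCurves

/-! At each point the curvature `K₁`, computed with respect to `s`, is a nonzero multiple of `α`, so
the two vanish together. In the positive definite case the multiple is `-½`: from `⟨𝐔', 𝐓⟩ = -1` one
gets `⟨𝐔', -𝐔' - ½⟨𝐔', 𝐔'⟩𝐓⟩ = -α + ½α` (`frenetK1_eq`). In general it is `-½ε`, and the point is
that `ε = ±1`.

The value of `ε` comes from the relations `⟨U^{(i)}, U^{(j)}⟩ = 0` for `i + j < 2r`, obtained by
repeatedly differentiating the nullity conditions (`IsChartedCurve.isNullChain`). They make
`𝐔^{(r)}` equal to `(0, u⁻¹U^{(r)} + lower terms, *)`, and they remove every lower term from its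
norm, which is therefore the sign of `⟨U^{(r)}, U^{(r)}⟩` (`IsNullChain.tractorMetric_self`).

Since `ε` and `α` are taken along `γ ∘ s⁻¹`, these relations must survive a change of parameter.
They do because the new derived vectors are triangular combinations of the old ones with powers of
the derivative of `s⁻¹` on the diagonal (`IsNullChain.comp`); `s⁻¹` is smooth by the inverse
function theorem. `IsLeading` is the bookkeeping common to both triangular expansions. -/

namespace ConformalCurves

/-! ### Smoothness of matrix operations -/

theorem contDiffOn_matrix_det {E m : Type*} [NormedAddCommGroup E] [NormedSpace ℝ E]
    [Fintype m] [DecidableEq m] {A : E → Matrix m m ℝ} {s : Set E}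
    (hA : ∀ i j, ContDiffOn ℝ ∞ (fun x => A x i j) s) :
    ContDiffOn ℝ ∞ (fun x => (A x).det) s := by
  simp only [Matrix.det_apply']
  exact ContDiffOn.sum fun σ _ => contDiffOn_const.mul (contDiffOn_prod fun i _ => hA _ _)

/-- Cramer's rule: each entry of the inverse is a cofactor determinant divided by `det A`. -/
theorem contDiffOn_matrix_inv {E m : Type*} [NormedAddCommGroup E] [NormedSpace ℝ E]
    [Fintype m] [DecidableEq m] {A : E → Matrix m m ℝ} {s : Set E}
    (hA : ∀ i j, ContDiffOn ℝ ∞ (fun x => A x i j) s) (hdet : ∀ x ∈ s, (A x).det ≠ 0) (i j : m) :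
    ContDiffOn ℝ ∞ (fun x => (A x)⁻¹ i j) s := by
  simp only [Matrix.inv_def, Matrix.smul_apply, Matrix.adjugate_apply, Ring.inverse_eq_inv',
    smul_eq_mul]
  refine ((contDiffOn_matrix_det hA).inv hdet).mul (contDiffOn_matrix_det fun k l => ?_)
  -- The cofactor is the determinant of `A` with row `j` replaced by a constant basis vector.
  by_cases hk : k = j
  · subst hk; simpa using contDiffOn_const
  · simpa [Matrix.updateRow_ne hk] using hA k l

/-! ### The metric in a chart -/

section Chart

variable {n p q : ℕ} {M : Type*} [TopologicalSpace M]
  [ChartedSpace (EuclideanSpace ℝ (Fin n)) M]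
  (g : PseudoMetric n p q M) {φ : OpenPartialHomeomorph M (EuclideanSpace ℝ (Fin n))}

theorem gMat_symm (x : EuclideanSpace ℝ (Fin n)) (i j : Fin n) :
    gMat g φ x i j = gMat g φ x j i := g.symm _ _ _

theorem gMat_transpose (x : EuclideanSpace ℝ (Fin n)) : (gMat g φ x).transpose = gMat g φ x := by
  ext i j; exact gMat_symm g x j i

/-- The matrix of the metric computes the metric on vectors given by their components. -/
theorem dotProduct_gMat_mulVec (x : EuclideanSpace ℝ (Fin n)) (v w : Fin n → ℝ) :
    v ⬝ᵥ (gMat g φ x).mulVec w =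
      g.form (φ.symm x) (mfderiv (𝓡 n) (𝓡 n) φ.symm x (WithLp.toLp 2 v))
        (mfderiv (𝓡 n) (𝓡 n) φ.symm x (WithLp.toLp 2 w)) := by
  have key : ∀ u : Fin n → ℝ, mfderiv (𝓡 n) (𝓡 n) φ.symm x (WithLp.toLp 2 u) =
      ∑ i, u i • coordVec φ x i := by
    intro u
    have hu : WithLp.toLp 2 u = ∑ i, u i • EuclideanSpace.single i (1 : ℝ) := by
      ext j
      simp [Pi.single_apply]
    rw [hu]
    erw [map_sum]
    refine Finset.sum_congr rfl fun i _ => ?_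
    erw [map_smul]
    rfl
  rw [key, key]
  simp only [map_sum, map_smul, LinearMap.sum_apply, LinearMap.smul_apply, smul_eq_mul,
    dotProduct, Matrix.mulVec, gMat, Matrix.of_apply, Finset.mul_sum]
  rw [Finset.sum_comm]
  exact Finset.sum_congr rfl fun i _ => Finset.sum_congr rfl fun j _ => by ring

/-- Nondegeneracy: pairing with a vector of an orthonormal basis reads off a coordinate up to sign.
-/
theorem PseudoMetric.eq_zero_of_form (x : M) (w : TangentSpace (𝓡 n) x)
    (h : ∀ v, g.form x v w = 0) : w = 0 := by
  obtain ⟨b, hb⟩ := g.signature x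
  have hw := b.sum_repr w
  have : ∀ i, b.repr w i = 0 := by
    intro i
    have h1 := h (b i)
    rw [← hw] at h1
    simp only [map_sum, map_smul, smul_eq_mul, hb] at h1
    rw [Finset.sum_eq_single i (by intro j _ hj; simp [Ne.symm hj]) (by simp)] at h1
    rcases i with i | i <;> simpa using h1
  rw [← hw]; simp [this]

/-- For `q = 0` there are no negative basis vectors, so the form is a sum of squares of coordinates.
-/
theorem PseudoMetric.form_self_pos (g : PseudoMetric n n 0 M) (x : M) (w : TangentSpace (𝓡 n) x)
    (hw : w ≠ 0) : 0 < g.form x w w := by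
  obtain ⟨b, hb⟩ := g.signature x
  have hr := b.sum_repr w
  have hs : g.form x w w = ∑ i, b.repr w i ^ 2 := by
    conv_lhs => rw [← hr]
    simp only [map_sum, map_smul, smul_eq_mul, LinearMap.sum_apply, LinearMap.smul_apply, hb]
    refine Finset.sum_congr rfl fun i _ => ?_
    rw [Finset.sum_eq_single i (by intro j _ hj; simp [hj]) (by simp)]
    rcases i with i | i
    · simp; ring
    · exact i.elim0
  rw [hs]
  refine lt_of_le_of_ne (Finset.sum_nonneg fun i _ => sq_nonneg _) fun h0 => hw ?_
  have h1 := (Finset.sum_eq_zero_iff_of_nonneg fun i _ => sq_nonneg (b.repr w i)).1 h0.symm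
  rw [← hr]
  exact Finset.sum_eq_zero fun i hi => by rw [pow_eq_zero_iff two_ne_zero |>.1 (h1 i hi), zero_smul]

theorem contDiffOn_gMat (hφ : φ ∈ atlas (EuclideanSpace ℝ (Fin n)) M) (i j : Fin n) :
    ContDiffOn ℝ ∞ (fun x => gMat g φ x i j) φ.target := g.smooth φ hφ i j

variable [IsManifold (𝓡 n) ∞ M]

theorem mfderiv_chart_symm_bijective (hφ : φ ∈ atlas (EuclideanSpace ℝ (Fin n)) M)
    {x : EuclideanSpace ℝ (Fin n)} (hx : x ∈ φ.target) :
    Function.Bijective (mfderiv (𝓡 n) (𝓡 n) φ.symm x) := by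
  have : IsManifold (𝓡 n) 1 M := IsManifold.of_le (n := ∞) (by exact_mod_cast le_top)
  exact (mdifferentiable_of_mem_atlas (I := 𝓡 n) hφ).symm.mfderiv_bijective hx

/-- A kernel vector of the matrix would give a tangent vector orthogonal to everything, since the
coordinate fields span; nondegeneracy and their independence force it to be zero. -/
theorem gMat_det_ne_zero (hφ : φ ∈ atlas (EuclideanSpace ℝ (Fin n)) M)
    {x : EuclideanSpace ℝ (Fin n)} (hx : x ∈ φ.target) : (gMat g φ x).det ≠ 0 := by
  intro h0
  obtain ⟨v, hv, hv0⟩ := Matrix.exists_mulVec_eq_zero_iff.2 h0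
  obtain ⟨hinj, hsurj⟩ := mfderiv_chart_symm_bijective hφ hx
  apply hv
  have : mfderiv (𝓡 n) (𝓡 n) φ.symm x (WithLp.toLp 2 v) = 0 := by
    refine g.eq_zero_of_form _ _ fun z => ?_
    obtain ⟨u, rfl⟩ := hsurj z
    have := dotProduct_gMat_mulVec g (φ := φ) x (WithLp.ofLp u) v
    rw [hv0, dotProduct_zero] at this
    exact this.symm
  have h2 := hinj (this.trans (map_zero _).symm)
  exact congrArg WithLp.ofLp h2

theorem dotProduct_gMat_mulVec_self_pos (g : PseudoMetric n n 0 M)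
    (hφ : φ ∈ atlas (EuclideanSpace ℝ (Fin n)) M)
    {x : EuclideanSpace ℝ (Fin n)} (hx : x ∈ φ.target) {v : Fin n → ℝ} (hv : v ≠ 0) :
    0 < v ⬝ᵥ (gMat g φ x).mulVec v := by
  rw [dotProduct_gMat_mulVec]
  refine g.form_self_pos _ _ fun h => hv ?_
  have h2 := (mfderiv_chart_symm_bijective hφ hx).1 (h.trans (map_zero _).symm)
  exact congrArg WithLp.ofLp h2

/-! ### Smoothness of the connection and curvature; metric compatibility. -/

theorem contDiffOn_pd {s : Set (EuclideanSpace ℝ (Fin n))} (hs : IsOpen s)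
    {f : EuclideanSpace ℝ (Fin n) → ℝ} (hf : ContDiffOn ℝ ∞ f s) (i : Fin n) :
    ContDiffOn ℝ ∞ (pd i f) s :=
  (hf.fderiv_of_isOpen hs (by simp)).clm_apply contDiffOn_const

theorem contDiffOn_gMat_inv (hφ : φ ∈ atlas (EuclideanSpace ℝ (Fin n)) M) (i j : Fin n) :
    ContDiffOn ℝ ∞ (fun x => (gMat g φ x)⁻¹ i j) φ.target :=
  contDiffOn_matrix_inv (contDiffOn_gMat g hφ) (fun _ hx => gMat_det_ne_zero g hφ hx) i j

theorem contDiffOn_christoffel (hφ : φ ∈ atlas (EuclideanSpace ℝ (Fin n)) M) (k i j : Fin n) :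
    ContDiffOn ℝ ∞ (christoffel g φ k i j) φ.target := by
  have h := fun a b c => contDiffOn_pd φ.open_target (contDiffOn_gMat g hφ a b) c
  exact contDiffOn_const.mul (ContDiffOn.sum fun l _ =>
    (contDiffOn_gMat_inv g hφ k l).mul (((h j l i).add (h i l j)).sub (h i j l)))

theorem contDiffOn_ricci (hφ : φ ∈ atlas (EuclideanSpace ℝ (Fin n)) M) (i j : Fin n) :
    ContDiffOn ℝ ∞ (ricci g φ i j) φ.target := by
  have h := contDiffOn_christoffel g hφ
  have h' := fun a b c d => contDiffOn_pd φ.open_target (contDiffOn_christoffel g hφ a b c) d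
  exact ContDiffOn.sum fun k _ => ((h' k i j k).sub (h' k i k j)).add
    (ContDiffOn.sum fun l _ => ((h k k l).mul (h l i j)).sub ((h k j l).mul (h l i k)))

theorem contDiffOn_schouten (hφ : φ ∈ atlas (EuclideanSpace ℝ (Fin n)) M) (i j : Fin n) :
    ContDiffOn ℝ ∞ (fun x => schouten g φ x i j) φ.target := by
  have hsc : ContDiffOn ℝ ∞ (scalarCurv g φ) φ.target :=
    ContDiffOn.sum fun i _ => ContDiffOn.sum fun j _ =>
      (contDiffOn_gMat_inv g hφ i j).mul (contDiffOn_ricci g hφ i j)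
  exact contDiffOn_const.mul ((contDiffOn_ricci g hφ i j).sub
    ((hsc.div_const _).mul (contDiffOn_gMat g hφ i j)))

/-- The Levi-Civita connection is metric: `∂ₖ g_{ij} = Γ^l_{ki} g_{lj} + Γ^l_{kj} g_{il}`. -/
theorem pd_gMat (hφ : φ ∈ atlas (EuclideanSpace ℝ (Fin n)) M)
    {x : EuclideanSpace ℝ (Fin n)} (hx : x ∈ φ.target) (k i j : Fin n) :
    pd k (fun y => gMat g φ y i j) x =
      ∑ l, (christoffel g φ l k i x * gMat g φ x l j +
        christoffel g φ l k j x * gMat g φ x i l) := by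
  -- Lowering the index gives the Christoffel symbols of the first kind; in the sum of the two
  -- needed here all but `∂ₖ g_{ij}` cancels.
  have lower : ∀ a b c : Fin n, ∑ l, gMat g φ x c l * christoffel g φ l a b x =
      (1 / 2) * (pd a (fun y => gMat g φ y b c) x + pd b (fun y => gMat g φ y a c) x
      - pd c (fun y => gMat g φ y a b) x) := by
    intro a b c
    have hinv : gMat g φ x * (gMat g φ x)⁻¹ = 1 :=
      Matrix.mul_nonsing_inv _ (isUnit_iff_ne_zero.2 (gMat_det_ne_zero g hφ hx))
    have h1 : (fun l => christoffel g φ l a b x) = (1 / 2 : ℝ) • (gMat g φ x)⁻¹.mulVec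
        (fun l => pd a (fun y => gMat g φ y b l) x + pd b (fun y => gMat g φ y a l) x
          - pd l (fun y => gMat g φ y a b) x) := rfl
    have h2 : (gMat g φ x).mulVec (fun l => christoffel g φ l a b x) c = _ :=
      congrFun (congrArg (gMat g φ x).mulVec h1) c
    rw [Matrix.mulVec_smul, Matrix.mulVec_mulVec, hinv, Matrix.one_mulVec] at h2
    exact h2
  rw [Finset.sum_add_distrib]
  have e1 := lower k i j
  have e2 := lower k j i
  have s : ∀ a b : Fin n, (fun y => gMat g φ y a b) = fun y => gMat g φ y b a :=
    fun a b => funext fun y => gMat_symm g y a b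
  have f1 : ∑ l, christoffel g φ l k i x * gMat g φ x l j =
      ∑ l, gMat g φ x j l * christoffel g φ l k i x :=
    Finset.sum_congr rfl fun l _ => by rw [gMat_symm g x l j, mul_comm]
  have f2 : ∑ l, christoffel g φ l k j x * gMat g φ x i l =
      ∑ l, gMat g φ x i l * christoffel g φ l k j x :=
    Finset.sum_congr rfl fun l _ => mul_comm _ _
  rw [f1, f2, e1, e2, s j i]
  ring

end Chart

/-! ### Calculus along a curve contained in a chart -/

/-- The curve `γ` is smooth on the open set `J`, and maps it into the domain of the chart `φ`. -/
structure IsChartedCurve {n : ℕ} {M : Type*} [TopologicalSpace M]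
    [ChartedSpace (EuclideanSpace ℝ (Fin n)) M]
    (φ : OpenPartialHomeomorph M (EuclideanSpace ℝ (Fin n))) (γ : ℝ → M) (J : Set ℝ) : Prop where
  mem_atlas : φ ∈ atlas (EuclideanSpace ℝ (Fin n)) M
  isOpen : IsOpen J
  mem_source : ∀ t ∈ J, γ t ∈ φ.source
  smooth : ContDiffOn ℝ ∞ (fun t => φ (γ t)) J

section Along

variable {n p q : ℕ} {M : Type*} [TopologicalSpace M]
  [ChartedSpace (EuclideanSpace ℝ (Fin n)) M]
  {g : PseudoMetric n p q M} {φ : OpenPartialHomeomorph M (EuclideanSpace ℝ (Fin n))}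
  {γ : ℝ → M} {J : Set ℝ}

variable (g φ γ) in
/-- The matrix `Γ^k_{ij} U^i` of the connection along the curve. -/
noncomputable def connMatrix (t : ℝ) : Matrix (Fin n) (Fin n) ℝ :=
  Matrix.of fun k j => ∑ i, christoffel g φ k i j (φ (γ t)) * tangent φ γ t i

theorem gAt_comm (t : ℝ) (v w : Fin n → ℝ) : gAt g φ γ t v w = gAt g φ γ t w v := by
  unfold gAt
  rw [Matrix.dotProduct_mulVec, ← Matrix.mulVec_transpose, gMat_transpose, dotProduct_comm]

theorem gAt_smul_left (t c : ℝ) (v z : Fin n → ℝ) :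
    gAt g φ γ t (c • v) z = c * gAt g φ γ t v z := smul_dotProduct _ _ _

theorem gAt_zero_left (t : ℝ) (z : Fin n → ℝ) : gAt g φ γ t 0 z = 0 := zero_dotProduct _

theorem gAt_sum_left {ι : Type*} (s : Finset ι) (t : ℝ) (v : ι → Fin n → ℝ) (z : Fin n → ℝ) :
    gAt g φ γ t (∑ i ∈ s, v i) z = ∑ i ∈ s, gAt g φ γ t (v i) z := sum_dotProduct _ _ _

/-- In this form the compatibility with the metric becomes a matrix computation. -/
theorem covD_eq (μ : ℝ → Fin n → ℝ) (t : ℝ) :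
    covD g φ γ μ t = (fun k => deriv (fun τ => μ τ k) t) + (connMatrix g φ γ t).mulVec (μ t) := by
  ext k
  simp only [covD, Pi.add_apply, Matrix.mulVec, dotProduct, connMatrix, Matrix.of_apply,
    Finset.sum_mul]
  rw [Finset.sum_comm]

theorem differentiableAt_component {E : ℝ → Fin n → ℝ} (hJ : IsOpen J) (hE : ContDiffOn ℝ ∞ E J)
    {t : ℝ} (ht : t ∈ J) (k : Fin n) : DifferentiableAt ℝ (fun τ => E τ k) t :=
  ((contDiffOn_pi.1 hE k).contDiffAt (hJ.mem_nhds ht)).differentiableAt (by simp)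

theorem covD_congr (hJ : IsOpen J) {v w : ℝ → Fin n → ℝ} (h : Set.EqOn v w J) :
    Set.EqOn (covD g φ γ v) (covD g φ γ w) J := by
  intro t ht
  rw [covD_eq, covD_eq, h ht]
  congr 1
  ext k
  refine Filter.EventuallyEq.deriv_eq ?_
  filter_upwards [hJ.mem_nhds ht] with τ hτ
  rw [h hτ]

theorem covD_zero : covD g φ γ (0 : ℝ → Fin n → ℝ) = 0 := by
  ext t k
  rw [covD_eq]
  simp

theorem covD_add (hJ : IsOpen J) {v w : ℝ → Fin n → ℝ} (hv : ContDiffOn ℝ ∞ v J)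
    (hw : ContDiffOn ℝ ∞ w J) {t : ℝ} (ht : t ∈ J) :
    covD g φ γ (v + w) t = covD g φ γ v t + covD g φ γ w t := by
  simp only [covD_eq, Pi.add_apply, Matrix.mulVec_add]
  have : (fun k => deriv (fun τ => v τ k + w τ k) t) =
      (fun k => deriv (fun τ => v τ k) t) + fun k => deriv (fun τ => w τ k) t := by
    ext k
    exact deriv_fun_add (differentiableAt_component hJ hv ht k)
      (differentiableAt_component hJ hw ht k)
  rw [this]
  abel

theorem covD_smul (hJ : IsOpen J) {c : ℝ → ℝ} {v : ℝ → Fin n → ℝ} (hc : ContDiffOn ℝ ∞ c J)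
    (hv : ContDiffOn ℝ ∞ v J) {t : ℝ} (ht : t ∈ J) :
    covD g φ γ (fun τ => c τ • v τ) t = deriv c t • v t + c t • covD g φ γ v t := by
  simp only [covD_eq, Matrix.mulVec_smul, smul_add]
  have : (fun k => deriv (fun τ => (c τ • v τ) k) t) =
      deriv c t • v t + c t • fun k => deriv (fun τ => v τ k) t := by
    ext k
    exact deriv_fun_mul ((hc.contDiffAt (hJ.mem_nhds ht)).differentiableAt (by simp))
      (differentiableAt_component hJ hv ht k)
  rw [this]
  abel

variable (h : IsChartedCurve φ γ J)

include h

theorem IsChartedCurve.mem_target {t : ℝ} (ht : t ∈ J) : φ (γ t) ∈ φ.target :=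
  φ.map_source (h.mem_source t ht)

theorem IsChartedCurve.contDiffOn_comp {f : EuclideanSpace ℝ (Fin n) → ℝ}
    (hf : ContDiffOn ℝ ∞ f φ.target) : ContDiffOn ℝ ∞ (fun t => f (φ (γ t))) J :=
  hf.comp h.smooth fun _ => h.mem_target

theorem IsChartedCurve.contDiffOn_tangent : ContDiffOn ℝ ∞ (tangent φ γ) J :=
  contDiffOn_pi.2 fun i =>
    ((contDiffOn_infty_iff_deriv_of_isOpen h.isOpen).1 (contDiffOn_euclidean.1 h.smooth i)).2

theorem IsChartedCurve.hasDerivAt_comp {f : EuclideanSpace ℝ (Fin n) → ℝ}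
    (hf : ContDiffOn ℝ ∞ f φ.target) {t : ℝ} (ht : t ∈ J) :
    HasDerivAt (fun t => f (φ (γ t))) (∑ k, pd k f (φ (γ t)) * tangent φ γ t k) t := by
  have h1 : DifferentiableAt ℝ f (φ (γ t)) :=
    (hf.contDiffAt (φ.open_target.mem_nhds (h.mem_target ht))).differentiableAt (by simp)
  have h2 : DifferentiableAt ℝ (fun t => φ (γ t)) t :=
    (h.smooth.contDiffAt (h.isOpen.mem_nhds ht)).differentiableAt (by simp)
  have h3 := h1.hasFDerivAt.comp_hasDerivAt t h2.hasDerivAt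
  -- Expanding the velocity in the standard basis turns the Fréchet derivative into a sum of partial
  -- derivatives.
  have h4 : deriv (fun t => φ (γ t)) t =
      ∑ k, tangent φ γ t k • EuclideanSpace.single k (1 : ℝ) := by
    ext i
    have hi := ((EuclideanSpace.proj i : EuclideanSpace ℝ (Fin n) →L[ℝ] ℝ).hasFDerivAt.comp_hasDerivAt
      t h2.hasDerivAt).deriv
    simpa [Pi.single_apply, tangent, Function.comp_def] using hi.symm
  rw [h4, map_sum] at h3
  simp only [map_smul, smul_eq_mul] at h3
  refine h3.congr_deriv (Finset.sum_congr rfl fun k _ => mul_comm _ _)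

theorem IsChartedCurve.contDiffOn_gAt {v w : ℝ → Fin n → ℝ} (hv : ContDiffOn ℝ ∞ v J)
    (hw : ContDiffOn ℝ ∞ w J) : ContDiffOn ℝ ∞ (fun t => gAt g φ γ t (v t) (w t)) J := by
  simp only [gAt, dotProduct, Matrix.mulVec]
  exact ContDiffOn.sum fun i _ => (contDiffOn_pi.1 hv i).mul (ContDiffOn.sum fun j _ =>
    (h.contDiffOn_comp (contDiffOn_gMat g h.mem_atlas i j)).mul (contDiffOn_pi.1 hw j))

variable [IsManifold (𝓡 n) ∞ M]

theorem IsChartedCurve.contDiffOn_covD {v : ℝ → Fin n → ℝ} (hv : ContDiffOn ℝ ∞ v J) :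
    ContDiffOn ℝ ∞ (covD g φ γ v) J := by
  refine contDiffOn_pi.2 fun k => ContDiffOn.add ?_ (ContDiffOn.sum fun i _ => ContDiffOn.sum
    fun j _ => ((h.contDiffOn_comp (contDiffOn_christoffel g h.mem_atlas k i j)).mul
      (contDiffOn_pi.1 h.contDiffOn_tangent i)).mul (contDiffOn_pi.1 hv j))
  exact ((contDiffOn_infty_iff_deriv_of_isOpen h.isOpen).1 (contDiffOn_pi.1 hv k)).2

theorem IsChartedCurve.contDiffOn_derivedVec (i : ℕ) :
    ContDiffOn ℝ ∞ (derivedVec g φ γ i) J := by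
  induction i with
  | zero => exact h.contDiffOn_tangent
  | succ i ih => exact h.contDiffOn_covD ih

/-- The covariant derivative along a curve is compatible with the metric. -/
theorem IsChartedCurve.hasDerivAt_gAt {v w : ℝ → Fin n → ℝ} (hv : ContDiffOn ℝ ∞ v J)
    (hw : ContDiffOn ℝ ∞ w J) {t : ℝ} (ht : t ∈ J) :
    HasDerivAt (fun τ => gAt g φ γ τ (v τ) (w τ))
      (gAt g φ γ t (covD g φ γ v t) (w t) + gAt g φ γ t (v t) (covD g φ γ w t)) t := by
  set G := gMat g φ (φ (γ t)) with hG
  set A := connMatrix g φ γ t with hA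
  set v' : Fin n → ℝ := fun k => deriv (fun τ => v τ k) t with hv'
  set w' : Fin n → ℝ := fun k => deriv (fun τ => w τ k) t with hw'
  -- This is `∇g = 0` contracted with the velocity: `G' = AᵀG + GA`, where `A` is the connection
  -- matrix along the curve.
  have dG : ∀ i j, HasDerivAt (fun τ => gMat g φ (φ (γ τ)) i j) ((A.transpose * G + G * A) i j) t := by
    intro i j
    refine (h.hasDerivAt_comp (contDiffOn_gMat g h.mem_atlas i j) ht).congr_deriv ?_
    simp only [pd_gMat g h.mem_atlas (h.mem_target ht), Matrix.add_apply, Matrix.mul_apply,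
      Matrix.transpose_apply, hA, hG, connMatrix, Matrix.of_apply, Finset.sum_mul, Finset.mul_sum,
      Finset.sum_add_distrib, add_mul]
    congr 1
    · rw [Finset.sum_comm]
      exact Finset.sum_congr rfl fun l _ => Finset.sum_congr rfl fun k _ => by ring
    · rw [Finset.sum_comm]
      exact Finset.sum_congr rfl fun l _ => Finset.sum_congr rfl fun k _ => by ring
  have dv : ∀ i, HasDerivAt (fun τ => v τ i) (v' i) t :=
    fun i => (differentiableAt_component h.isOpen hv ht i).hasDerivAt
  have dw : ∀ i, HasDerivAt (fun τ => w τ i) (w' i) t :=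
    fun i => (differentiableAt_component h.isOpen hw ht i).hasDerivAt
  have key := HasDerivAt.fun_sum (u := Finset.univ) fun i _ => (dv i).mul
    (HasDerivAt.fun_sum (u := Finset.univ) fun j _ => (dG i j).mul (dw j))
  refine key.congr_deriv ?_
  have e1 : gAt g φ γ t (covD g φ γ v t) (w t) + gAt g φ γ t (v t) (covD g φ γ w t) =
      v' ⬝ᵥ G.mulVec (w t) + v t ⬝ᵥ ((A.transpose * G + G * A).mulVec (w t) + G.mulVec w') := by
    rw [covD_eq, covD_eq]
    simp only [gAt, ← hG, ← hA, ← hv', ← hw', add_dotProduct, dotProduct_add, Matrix.mulVec_add,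
      Matrix.add_mulVec, ← Matrix.mulVec_mulVec]
    have : A.mulVec (v t) ⬝ᵥ G.mulVec (w t) = v t ⬝ᵥ A.transpose.mulVec (G.mulVec (w t)) := by
      rw [Matrix.dotProduct_mulVec (v t), Matrix.vecMul_transpose]
    rw [this]
    ring
  rw [e1]
  simp only [Finset.sum_add_distrib, dotProduct, Matrix.mulVec, Pi.add_apply, mul_add]
  rfl

end Along

/-! ### Triangular combinations of a moving sequence of vectors -/

/-- On `J`, the vector field `v` is a combination of `E₀, …, Eᵢ` with smooth coefficients, the
coefficient of `Eᵢ` being `a`. -/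
def IsLeading {n : ℕ} (J : Set ℝ) (E : ℕ → ℝ → Fin n → ℝ) (i : ℕ) (a : ℝ → ℝ)
    (v : ℝ → Fin n → ℝ) : Prop :=
  ∃ c : ℕ → ℝ → ℝ, (∀ j, ContDiffOn ℝ ∞ (c j) J) ∧ (∀ t ∈ J, c i t = a t) ∧
    ∀ t ∈ J, v t = ∑ j ∈ Finset.range (i + 1), c j t • E j t

section Leading

variable {n p q : ℕ} {M : Type*} [TopologicalSpace M]
  [ChartedSpace (EuclideanSpace ℝ (Fin n)) M]
  {g : PseudoMetric n p q M} {φ : OpenPartialHomeomorph M (EuclideanSpace ℝ (Fin n))}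
  {γ : ℝ → M} {J : Set ℝ} {E : ℕ → ℝ → Fin n → ℝ} {i : ℕ} {a b : ℝ → ℝ} {v w : ℝ → Fin n → ℝ}

theorem IsLeading.zero (ha : ContDiffOn ℝ ∞ a J) (h : ∀ t ∈ J, v t = a t • E 0 t) :
    IsLeading J E 0 a v :=
  ⟨fun _ => a, fun _ => ha, fun _ _ => rfl, fun t ht => by simp [h t ht]⟩

theorem IsLeading.congr (h : IsLeading J E i a v) (hw : ∀ t ∈ J, w t = v t) :
    IsLeading J E i a w :=
  let ⟨c, h1, h2, h3⟩ := h
  ⟨c, h1, h2, fun t ht => (hw t ht).trans (h3 t ht)⟩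

theorem IsLeading.contDiffOn (hE : ∀ j, ContDiffOn ℝ ∞ (E j) J) (h : IsLeading J E i a v) :
    ContDiffOn ℝ ∞ v J := by
  obtain ⟨c, h1, -, h3⟩ := h
  exact (ContDiffOn.sum (s := Finset.range (i + 1)) fun j _ => (h1 j).smul (hE j)).congr
    fun t ht => by simp [h3 t ht]

/-- Adding a multiple of `E₀` does not change the leading coefficient of a field of positive
order. -/
theorem IsLeading.add_smul_zero (h : IsLeading J E (i + 1) a v) (hb : ContDiffOn ℝ ∞ b J) :
    IsLeading J E (i + 1) a (fun t => v t + b t • E 0 t) := by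
  obtain ⟨c, h1, h2, h3⟩ := h
  refine ⟨fun j => if j = 0 then c 0 + b else c j, fun j => ?_, fun t ht => ?_, fun t ht => ?_⟩
  · dsimp only
    split_ifs
    · exact (h1 0).add hb
    · exact h1 j
  · simpa using h2 t ht
  · dsimp only
    rw [Finset.sum_range_succ', h3 t ht, Finset.sum_range_succ']
    simp [add_smul, add_assoc]

/-- When both combinations are expanded, every pair other than `(i, i')` has smaller index sum and
is killed by the orthogonality hypothesis. -/
theorem IsLeading.gAt_eq {i' : ℕ} (hv : IsLeading J E i a v) (hw : IsLeading J E i' b w) {t : ℝ}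
    (ht : t ∈ J) (hE : ∀ j ≤ i, ∀ j' ≤ i', j + j' < i + i' → gAt g φ γ t (E j t) (E j' t) = 0) :
    gAt g φ γ t (v t) (w t) = a t * b t * gAt g φ γ t (E i t) (E i' t) := by
  obtain ⟨c, -, h2, h3⟩ := hv
  obtain ⟨d, -, k2, k3⟩ := hw
  rw [h3 t ht, gAt_sum_left, Finset.sum_range_succ, Finset.sum_eq_zero, zero_add, gAt_smul_left,
    gAt_comm, k3 t ht, gAt_sum_left, Finset.sum_range_succ, Finset.sum_eq_zero, zero_add,
    gAt_smul_left, gAt_comm, h2 t ht, k2 t ht, mul_assoc]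
  · intro j hj
    rw [Finset.mem_range] at hj
    rw [gAt_smul_left, gAt_comm, hE i le_rfl j hj.le (by lia), mul_zero]
  · intro j hj
    rw [Finset.mem_range] at hj
    rw [gAt_smul_left, gAt_comm, k3 t ht, gAt_sum_left, Finset.sum_eq_zero, mul_zero]
    intro j' hj'
    rw [Finset.mem_range] at hj'
    rw [gAt_smul_left, gAt_comm, hE j hj.le j' (by lia) (by lia), mul_zero]

theorem covD_sum (hJ : IsOpen J) {ι : Type*} (s : Finset ι) {V : ι → ℝ → Fin n → ℝ}
    (hV : ∀ j, ContDiffOn ℝ ∞ (V j) J) {t : ℝ} (ht : t ∈ J) :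
    covD g φ γ (∑ j ∈ s, V j) t = ∑ j ∈ s, covD g φ γ (V j) t := by
  classical
  induction s using Finset.induction_on with
  | empty => simp [covD_zero]
  | insert j s hj ih =>
    have hs : ContDiffOn ℝ ∞ (∑ j ∈ s, V j) J :=
      (ContDiffOn.sum (s := s) fun j _ => hV j).congr fun t _ => by simp
    rw [Finset.sum_insert hj, Finset.sum_insert hj, covD_add hJ (hV j) hs ht, ih]

/-- If `D Eⱼ = k Eⱼ₊₁`, covariant differentiation raises the order by one and multiplies the
leading coefficient by `k`. -/
theorem IsLeading.covD {k : ℝ → ℝ} (hJ : IsOpen J) (hE : ∀ j, ContDiffOn ℝ ∞ (E j) J)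
    (hk : ContDiffOn ℝ ∞ k J)
    (hD : ∀ j, ∀ t ∈ J, covD g φ γ (E j) t = k t • E (j + 1) t) (h : IsLeading J E i a v) :
    IsLeading J E (i + 1) (fun t => k t * a t) (covD g φ γ v) := by
  obtain ⟨c, h1, h2, h3⟩ := h
  -- The product rule gives the coefficients `cⱼ' + k cⱼ₋₁`. Beyond index `i` the functions `cⱼ` are
  -- arbitrary, so the first guard keeps the derivative of `cᵢ₊₁` out of the new leading
  -- coefficient.
  refine ⟨fun j t => (if j ≤ i then deriv (c j) t else 0) +
    (if j = 0 then 0 else k t * c (j - 1) t), fun j => ?_, fun t ht => ?_, fun t ht => ?_⟩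
  · refine ContDiffOn.add ?_ ?_
    · split_ifs
      · exact ((contDiffOn_infty_iff_deriv_of_isOpen hJ).1 (h1 j)).2
      · exact contDiffOn_const
    · split_ifs
      · exact contDiffOn_const
      · exact hk.mul (h1 _)
  · simp [h2 t ht]
  · have e1 : ConformalCurves.covD g φ γ v t =
        ConformalCurves.covD g φ γ (∑ j ∈ Finset.range (i + 1), fun τ => c j τ • E j τ) t :=
      covD_congr hJ (fun τ hτ => by simp [h3 τ hτ]) ht
    rw [e1, covD_sum (V := fun j τ => c j τ • E j τ) hJ _ (fun j => (h1 j).smul (hE j)) ht]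
    simp only [covD_smul hJ (h1 _) (hE _) ht, hD _ t ht, add_smul, Finset.sum_add_distrib]
    congr 1
    · rw [Finset.sum_range_succ _ (i + 1)]
      simp only [add_le_iff_nonpos_right, nonpos_iff_eq_zero, one_ne_zero, if_false, zero_smul,
        add_zero]
      refine Finset.sum_congr rfl fun j hj => ?_
      rw [if_pos (by simpa [Nat.lt_succ_iff] using hj)]
    · rw [Finset.sum_range_succ' _ (i + 1)]
      simp [smul_smul, mul_comm]

end Leading

/-! ### Null curves in a chart -/

section Null

variable {n p q : ℕ} {M : Type*} [TopologicalSpace M]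
  [ChartedSpace (EuclideanSpace ℝ (Fin n)) M]
  {g : PseudoMetric n p q M} {φ : OpenPartialHomeomorph M (EuclideanSpace ℝ (Fin n))}
  {γ : ℝ → M} {r : ℕ} {J : Set ℝ}

/-! ### Reparametrization -/

theorem tangent_comp {J' : Set ℝ} {σ : ℝ → ℝ} (h : IsChartedCurve φ γ J) (hJ' : IsOpen J')
    (hσ : ContDiffOn ℝ ∞ σ J') (hm : Set.MapsTo σ J' J) {t : ℝ} (ht : t ∈ J') :
    tangent φ (γ ∘ σ) t = deriv σ t • tangent φ γ (σ t) := by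
  have h1 : DifferentiableAt ℝ σ t := (hσ.contDiffAt (hJ'.mem_nhds ht)).differentiableAt (by simp)
  ext k
  have h2 : DifferentiableAt ℝ (fun τ => φ (γ τ) k) (σ t) :=
    ((contDiffOn_euclidean.1 h.smooth k).contDiffAt
      (h.isOpen.mem_nhds (hm ht))).differentiableAt (by simp)
  have h3 := (h2.hasDerivAt.comp t h1.hasDerivAt).deriv
  rw [mul_comm] at h3
  exact h3

/-- The connection term is linear in the velocity, so it picks up the same factor `σ'` as the
ordinary derivative. -/
theorem covD_comp {J' : Set ℝ} {σ : ℝ → ℝ} (h : IsChartedCurve φ γ J) (hJ' : IsOpen J')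
    (hσ : ContDiffOn ℝ ∞ σ J') (hm : Set.MapsTo σ J' J) {v : ℝ → Fin n → ℝ}
    (hv : ContDiffOn ℝ ∞ v J) {t : ℝ} (ht : t ∈ J') :
    covD g φ (γ ∘ σ) (fun τ => v (σ τ)) t = deriv σ t • covD g φ γ v (σ t) := by
  have h1 : DifferentiableAt ℝ σ t := (hσ.contDiffAt (hJ'.mem_nhds ht)).differentiableAt (by simp)
  ext k
  have h2 := ((differentiableAt_component h.isOpen hv (hm ht) k).hasDerivAt.comp t
    h1.hasDerivAt).deriv
  simp only [Function.comp_def] at h2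
  simp only [covD, h2, tangent_comp h hJ' hσ hm ht, Pi.smul_apply, smul_eq_mul, mul_add,
    Finset.mul_sum, Function.comp_apply]
  congr 1
  · ring
  · exact Finset.sum_congr rfl fun i _ => Finset.sum_congr rfl fun j _ => by ring

theorem IsChartedCurve.comp {J' : Set ℝ} {σ : ℝ → ℝ} (h : IsChartedCurve φ γ J)
    (hJ' : IsOpen J') (hσ : ContDiffOn ℝ ∞ σ J') (hm : Set.MapsTo σ J' J) :
    IsChartedCurve φ (γ ∘ σ) J' :=
  ⟨h.mem_atlas, hJ', fun _ ht => h.mem_source _ (hm ht), h.smooth.comp hσ hm⟩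

/-! ### Orthogonality relations -/

variable (g φ γ r J) in
/-- The orthogonality relations among the derived vectors of an `r`-null curve. -/
structure IsNullChain : Prop where
  orthogonal : ∀ t ∈ J, ∀ i j, i + j < 2 * r →
    gAt g φ γ t (derivedVec g φ γ i t) (derivedVec g φ γ j t) = 0
  nonnull : ∀ t ∈ J, gAt g φ γ t (derivedVec g φ γ r t) (derivedVec g φ γ r t) ≠ 0

theorem density_sq (t : ℝ) : density g φ γ r t ^ 2 =
    |gAt g φ γ t (derivedVec g φ γ r t) (derivedVec g φ γ r t)| := Real.sq_sqrt (abs_nonneg _)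

variable [IsManifold (𝓡 n) ∞ M]

/-- Differentiating `⟨U^{(i)}, U^{(j)}⟩ = 0` trades one relation for another with the same index
sum. Induction on the gap `d = j - i`: gap `0` is nullity, gap `1` is half its derivative, and gap
`d + 2` at `i` follows from gap `d + 1` at `i` and gap `d` at `i + 1`. -/
theorem IsChartedCurve.isNullChain (h : IsChartedCurve φ γ J)
    (h0 : ∀ t ∈ J, ∀ i < r, gAt g φ γ t (derivedVec g φ γ i t) (derivedVec g φ γ i t) = 0)
    (h1 : ∀ t ∈ J, gAt g φ γ t (derivedVec g φ γ r t) (derivedVec g φ γ r t) ≠ 0) :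
    IsNullChain g φ γ r J := by
  refine ⟨?_, h1⟩
  have key : ∀ d i, 2 * i + d < 2 * r → ∀ t ∈ J,
      gAt g φ γ t (derivedVec g φ γ i t) (derivedVec g φ γ (i + d) t) = 0 := by
    have hder : ∀ i j, (∀ t ∈ J,
        gAt g φ γ t (derivedVec g φ γ i t) (derivedVec g φ γ j t) = 0) → ∀ t ∈ J,
        gAt g φ γ t (derivedVec g φ γ (i + 1) t) (derivedVec g φ γ j t) +
          gAt g φ γ t (derivedVec g φ γ i t) (derivedVec g φ γ (j + 1) t) = 0 := by
      intro i j hij t ht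
      have hd := h.hasDerivAt_gAt (g := g) (h.contDiffOn_derivedVec (g := g) i)
        (h.contDiffOn_derivedVec (g := g) j) ht
      refine hd.unique ((hasDerivAt_const t (0 : ℝ)).congr_of_eventuallyEq ?_)
      filter_upwards [h.isOpen.mem_nhds ht] with τ hτ using hij τ hτ
    intro d
    induction d using Nat.strong_induction_on with
    | _ d ih =>
      intro i hi t ht
      match d, ih with
      | 0, _ => exact h0 t ht i (by lia)
      | 1, ih =>
        have := hder i i (fun t ht => h0 t ht i (by lia)) t ht
        rw [gAt_comm] at this
        linarith
      | d + 2, ih =>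
        have := hder i (i + (d + 1)) (ih (d + 1) (by lia) i (by lia)) t ht
        have h2 := ih d (by lia) (i + 1) (by lia) t ht
        rw [show i + 1 + d = i + (d + 1) by lia] at h2
        rw [h2, zero_add] at this
        exact this
  intro t ht i j hij
  rcases le_total i j with hle | hle
  · obtain ⟨d, rfl⟩ := Nat.exists_eq_add_of_le hle
    exact key d i (by lia) t ht
  · obtain ⟨d, rfl⟩ := Nat.exists_eq_add_of_le hle
    rw [gAt_comm]
    exact key d j (by lia) t ht

/-- The fields `U^{(j)} ∘ σ` satisfy `D Eⱼ = σ' Eⱼ₊₁`, so each differentiation contributes one more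
factor `σ'` to the top coefficient; the tangent vector already carries one. -/
theorem IsChartedCurve.isLeading_derivedVec_comp {J' : Set ℝ} {σ : ℝ → ℝ}
    (h : IsChartedCurve φ γ J) (hJ' : IsOpen J') (hσ : ContDiffOn ℝ ∞ σ J')
    (hm : Set.MapsTo σ J' J) (i : ℕ) :
    IsLeading J' (fun j t => derivedVec g φ γ j (σ t)) i (fun t => deriv σ t ^ (i + 1))
      (derivedVec g φ (γ ∘ σ) i) := by
  have hσ' := ((contDiffOn_infty_iff_deriv_of_isOpen hJ').1 hσ).2
  induction i with
  | zero =>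
    exact IsLeading.zero (by simpa using hσ') fun t ht => by
      simpa [derivedVec] using tangent_comp h hJ' hσ hm ht
  | succ i ih =>
    have := ih.covD (g := g) (φ := φ) (γ := γ ∘ σ) hJ'
      (fun j => (h.contDiffOn_derivedVec j).comp hσ hm) hσ'
      (fun j t ht => covD_comp h hJ' hσ hm (h.contDiffOn_derivedVec j) ht)
    simp only [pow_succ' _ (i + 1)]
    exact this

/-- The orthogonality relations do not depend on the parameter. -/
theorem IsNullChain.comp {J' : Set ℝ} {σ : ℝ → ℝ} (hN : IsNullChain g φ γ r J)
    (h : IsChartedCurve φ γ J) (hJ' : IsOpen J') (hσ : ContDiffOn ℝ ∞ σ J')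
    (hm : Set.MapsTo σ J' J) (hσ0 : ∀ t ∈ J', deriv σ t ≠ 0) :
    IsNullChain g φ (γ ∘ σ) r J' := by
  -- For `i ≤ r` all the pairs below the top have index sum less than `2r`, so the norm merely
  -- rescales.
  have key : ∀ t ∈ J', ∀ i ≤ r,
      gAt g φ (γ ∘ σ) t (derivedVec g φ (γ ∘ σ) i t) (derivedVec g φ (γ ∘ σ) i t) =
      deriv σ t ^ (i + 1) * deriv σ t ^ (i + 1) *
        gAt g φ γ (σ t) (derivedVec g φ γ i (σ t)) (derivedVec g φ γ i (σ t)) := by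
    intro t ht i hi
    have hl := h.isLeading_derivedVec_comp (g := g) hJ' hσ hm i
    exact hl.gAt_eq hl ht fun j hj j' hj' hjj' => hN.orthogonal (σ t) (hm ht) j j' (by lia)
  refine (h.comp hJ' hσ hm).isNullChain (fun t ht i hi => ?_) fun t ht => ?_
  · rw [key t ht i hi.le, hN.orthogonal (σ t) (hm ht) i i (by lia), mul_zero]
  · rw [key t ht r le_rfl]
    exact mul_ne_zero (mul_ne_zero (pow_ne_zero _ (hσ0 t ht)) (pow_ne_zero _ (hσ0 t ht)))
      (hN.nonnull _ (hm ht))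

/-! ### The first derived tractors of a null curve -/

/-- Absolute value and square root are smooth away from zero, where `U^{(r)}` being non-null keeps
the argument. -/
theorem IsNullChain.contDiffOn_density_inv (hN : IsNullChain g φ γ r J)
    (h : IsChartedCurve φ γ J) : ContDiffOn ℝ ∞ (fun t => (density g φ γ r t)⁻¹) J := by
  have h1 := (h.contDiffOn_gAt (g := g) (h.contDiffOn_derivedVec r)
    (h.contDiffOn_derivedVec r)).abs hN.nonnull
  exact (h1.sqrt fun t ht => abs_ne_zero.2 (hN.nonnull t ht)).inv fun t ht =>
    Real.sqrt_ne_zero'.2 (abs_pos.2 (hN.nonnull t ht))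

/-- For `i ≤ r`, the tractor `𝐔^{(i)}` of an `r`-null curve is
`(0, u⁻¹ U^{(i)} + lower order terms, *)`. -/
theorem IsNullChain.tractor_succ (hN : IsNullChain g φ γ r J) (h : IsChartedCurve φ γ J)
    (i : ℕ) (hi : i ≤ r) :
    (∀ t ∈ J, (tractor g φ γ r (i + 1) t).1 = 0) ∧
    IsLeading J (derivedVec g φ γ) i (fun t => (density g φ γ r t)⁻¹)
      (fun t => (tractor g φ γ r (i + 1) t).2.1) ∧
    ContDiffOn ℝ ∞ (fun t => (tractor g φ γ r (i + 1) t).2.2) J := by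
  have hu := hN.contDiffOn_density_inv h
  have hder : ∀ {f : ℝ → ℝ}, ContDiffOn ℝ ∞ f J → ContDiffOn ℝ ∞ (deriv f) J :=
    fun hf => ((contDiffOn_infty_iff_deriv_of_isOpen h.isOpen).1 hf).2
  induction i with
  | zero =>
    refine ⟨fun t ht => ?_, IsLeading.zero hu fun t ht => ?_, (hder hu).congr fun t ht => ?_⟩
    · simp [tractor, tractorD, gAt]
    · have : covD g φ γ (fun _ => 0) t = 0 := congrFun covD_zero t
      simp [tractor, tractorD, this, derivedVec]
    · simp [tractor, tractorD]
  | succ i ih =>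
    obtain ⟨h1, h2, h3⟩ := ih (by lia)
    have hs := h2.contDiffOn h.contDiffOn_derivedVec
    refine ⟨fun t ht => ?_, ?_, (hder h3).sub ?_⟩
    · have e1 : deriv (fun τ => (tractor g φ γ r (i + 1) τ).1) t = 0 := by
        have : (fun τ => (tractor g φ γ r (i + 1) τ).1) =ᶠ[nhds t] fun _ => 0 := by
          filter_upwards [h.isOpen.mem_nhds ht] with τ hτ using h1 τ hτ
        rw [this.deriv_eq, deriv_const]
      -- The new first slot is `-⟨u⁻¹U^{(i)} + …, U⟩`; viewing `U` as a field of order `0` reduces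
      -- it to relations of index sum at most `i < 2r`.
      have h0 : IsLeading J (derivedVec g φ γ) 0 (fun _ => 1) (tangent φ γ) :=
        IsLeading.zero contDiffOn_const fun t _ => by simp [derivedVec]
      have e2 := h2.gAt_eq h0 ht fun j hj j' hj' _ => hN.orthogonal t ht j j' (by lia)
      rw [hN.orthogonal t ht i 0 (by lia), mul_zero] at e2
      show deriv (fun τ => (tractor g φ γ r (i + 1) τ).1) t - _ = 0
      rw [e1, zero_sub, neg_eq_zero]
      exact e2
    · have hd := h2.covD (g := g) (φ := φ) (γ := γ) (k := fun _ => 1) h.isOpen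
        h.contDiffOn_derivedVec contDiffOn_const fun j t _ => by simp [derivedVec]
      simp only [one_mul] at hd
      -- The term `ρU` of the tractor connection only affects the coefficient of `U^{(0)}`, and the
      -- Schouten term vanishes because the first slot of `𝐔^{(i)}` does.
      refine (hd.add_smul_zero h3).congr fun t ht => ?_
      show _ + _ + (tractor g φ γ r (i + 1) t).1 • _ = _
      rw [h1 t ht, zero_smul, add_zero]
      rfl
    · simp only [dotProduct, Matrix.mulVec]
      exact ContDiffOn.sum fun k _ => (contDiffOn_pi.1 h.contDiffOn_tangent k).mul
        (ContDiffOn.sum fun l _ =>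
          (h.contDiffOn_comp (contDiffOn_schouten g h.mem_atlas k l)).mul (contDiffOn_pi.1 hs l))

/-- The first slot is zero, so the last one does not contribute; the middle slot has norm
`u⁻²⟨U^{(r)}, U^{(r)}⟩`, and `u²` is the absolute value of that product. -/
theorem IsNullChain.tractorMetric_self (hN : IsNullChain g φ γ r J) (h : IsChartedCurve φ γ J)
    {t : ℝ} (ht : t ∈ J) :
    tractorMetric g φ γ t (tractor g φ γ r (r + 1) t) (tractor g φ γ r (r + 1) t) =
      (SignType.sign (gAt g φ γ t (derivedVec g φ γ r t) (derivedVec g φ γ r t)) : ℝ) := by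
  obtain ⟨h1, h2, -⟩ := hN.tractor_succ h r le_rfl
  have hu := density_sq (g := g) (φ := φ) (γ := γ) (r := r) t
  have e := h2.gAt_eq h2 ht fun j hj j' hj' _ => hN.orthogonal t ht j j' (by lia)
  rw [tractorMetric, h1 t ht, e, ← mul_inv, ← sq, hu]
  have h0 := abs_ne_zero.2 (hN.nonnull t ht)
  rw [zero_mul, mul_zero, add_zero, add_zero, inv_mul_eq_iff_eq_mul₀ h0, mul_comm, sign_mul_abs]

end Null

/-! ### Parameters -/

section Parameter

variable {I : Set ℝ} {s : ℝ → ℝ}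

/-- Rolle's theorem: two equal values would force a critical point between them, hence in the
interval. -/
theorem IsParameter.injOn (hIc : I.OrdConnected) (hs : IsParameter I s) :
    Set.InjOn s I := by
  have key : ∀ a ∈ I, ∀ b ∈ I, a < b → s a ≠ s b := by
    intro a ha b hb hab he
    obtain ⟨c, hc, hc0⟩ := exists_deriv_eq_zero hab
      (hs.1.continuousOn.mono (hIc.out ha hb)) he
    exact hs.2 c (hIc.out ha hb (Set.Ioo_subset_Icc_self hc)) hc0
  intro a ha b hb he
  rcases lt_trichotomy a b with h | h | h
  · exact (key a ha b hb h he).elim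
  · exact h
  · exact (key b hb a ha h he.symm).elim

theorem IsParameter.hasStrictDerivAt (hIo : IsOpen I) (hs : IsParameter I s) {t : ℝ}
    (ht : t ∈ I) : HasStrictDerivAt s (deriv s t) t :=
  (hs.1.contDiffAt (hIo.mem_nhds ht)).hasStrictDerivAt (by simp)

theorem IsParameter.isOpen_image (hIo : IsOpen I) (hs : IsParameter I s) {J : Set ℝ}
    (hJ : IsOpen J) (hJI : J ⊆ I) : IsOpen (s '' J) := by
  rw [isOpen_iff_mem_nhds]
  rintro _ ⟨t, ht, rfl⟩
  rw [← (hs.hasStrictDerivAt hIo (hJI ht)).map_nhds_eq (hs.2 t (hJI ht))]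
  exact Filter.image_mem_map (hJ.mem_nhds ht)

theorem IsParameter.invFunOn_apply (hIc : I.OrdConnected) (hs : IsParameter I s)
    {t : ℝ} (ht : t ∈ I) : Function.invFunOn s I (s t) = t :=
  (hs.injOn hIc).leftInvOn_invFunOn ht

/-- The inverse function theorem provides a smooth local inverse, and injectivity of `s` on `I`
forces the global inverse to agree with it near `s t`. -/
theorem IsParameter.contDiffAt_invFunOn (hIo : IsOpen I) (hIc : I.OrdConnected)
    (hs : IsParameter I s) {t : ℝ} (ht : t ∈ I) :
    ContDiffAt ℝ ∞ (Function.invFunOn s I) (s t) := by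
  have hc := hs.1.contDiffAt (hIo.mem_nhds ht)
  have hd := hs.hasStrictDerivAt hIo ht
  set e := hc.toOpenPartialHomeomorph s (hd.hasDerivAt.hasFDerivAt_equiv (hs.2 t ht)) (by simp)
    with he
  have hcoe : (e : ℝ → ℝ) = s := hc.toOpenPartialHomeomorph_coe _ _
  have hmem : t ∈ e.source := hc.mem_toOpenPartialHomeomorph_source _ _
  have hst : e.symm (s t) = t := by rw [← hcoe]; exact e.left_inv hmem
  have htar : s t ∈ e.target := by rw [← hcoe]; exact e.map_source hmem
  have hsm : ContDiffAt ℝ ∞ e.symm (s t) := by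
    refine e.contDiffAt_symm_deriv (hs.2 t ht) htar ?_ ?_
    · rw [hcoe, hst]; exact hd.hasDerivAt
    · rw [hcoe, hst]; exact hc
  refine hsm.congr_of_eventuallyEq ?_
  -- The two inverses can be compared only where the local one takes values in `I`.
  have hI : ∀ᶠ y in nhds (s t), e.symm y ∈ I :=
    hsm.continuousAt.eventually (by rw [hst]; exact hIo.mem_nhds ht)
  filter_upwards [hI, e.open_target.mem_nhds htar] with y hy hy'
  have hse : s (e.symm y) = y := by rw [← hcoe]; exact e.right_inv hy'
  conv_lhs => rw [← hse]
  exact hs.invFunOn_apply hIc hy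

/-- By the chain rule for `s⁻¹ ∘ s = id`, a zero derivative would give `0 = 1`. -/
theorem IsParameter.deriv_invFunOn_ne_zero (hIo : IsOpen I) (hIc : I.OrdConnected)
    (hs : IsParameter I s) {t : ℝ} (ht : t ∈ I) : deriv (Function.invFunOn s I) (s t) ≠ 0 := by
  intro h0
  have h1 := ((hs.contDiffAt_invFunOn hIo hIc ht).differentiableAt (by simp)).hasDerivAt
  have h2 := h1.comp t (hs.hasStrictDerivAt hIo ht).hasDerivAt
  rw [h0, zero_mul] at h2
  have h3 : HasDerivAt (Function.invFunOn s I ∘ s) 1 t := by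
    refine (hasDerivAt_id t).congr_of_eventuallyEq ?_
    filter_upwards [hIo.mem_nhds ht] with τ hτ using hs.invFunOn_apply hIc hτ
  exact zero_ne_one (h2.unique h3)

theorem IsParameter.reparam_apply {M : Type*} {γ : ℝ → M} (hIc : I.OrdConnected)
    (hs : IsParameter I s) {t : ℝ} (ht : t ∈ I) : reparam γ I s (s t) = γ t :=
  congrArg γ (hs.invFunOn_apply hIc ht)

end Parameter

/-! ### The first conformal curvature -/

section Curvature

variable {n p q : ℕ} {M : Type*} [TopologicalSpace M]
  [ChartedSpace (EuclideanSpace ℝ (Fin n)) M]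
  {g : PseudoMetric n p q M} {γ : ℝ → M} {r : ℕ} {I : Set ℝ} {s : ℝ → ℝ}

/-- The relation `K₁ = -½ ⟨𝐔', 𝐔'⟩` along a space-like curve. -/
theorem frenetK1_eq {t : ℝ} (hpos : 0 < gAt g (chartAt (EuclideanSpace ℝ (Fin n)) (γ t)) γ t
      (tangent (chartAt (EuclideanSpace ℝ (Fin n)) (γ t)) γ t)
      (tangent (chartAt (EuclideanSpace ℝ (Fin n)) (γ t)) γ t)) :
    frenetK1 g γ t = -(1 / 2) * alpha g γ 0 t := by
  set φ := chartAt (EuclideanSpace ℝ (Fin n)) (γ t) with hφ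
  set u := (density g φ γ 0 t)⁻¹ with hu
  set V : Tractor n := tractor g φ γ 0 2 t with hV
  -- This normalisation amounts to `⟨𝐔', 𝐓⟩ = -1`; positivity removes the absolute value from the
  -- density.
  have hu2 : u * u * gAt g φ γ t (tangent φ γ t) (tangent φ γ t) = 1 := by
    rw [hu, ← mul_inv, ← sq, density_sq, derivedVec, abs_of_pos hpos, inv_mul_cancel₀ hpos.ne']
  have h1 : ∀ τ, (tractor g φ γ 0 1 τ).1 = 0 := by
    intro τ
    simp [tractor, tractorD, gAt]
  have h2 : (tractor g φ γ 0 1 t).2.1 = u • tangent φ γ t := by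
    have : covD g φ γ (fun _ => 0) t = 0 := congrFun covD_zero t
    simp [tractor, tractorD, this, hu]
  have hV1 : V.1 = -(u * gAt g φ γ t (tangent φ γ t) (tangent φ γ t)) := by
    show deriv (fun τ => (tractor g φ γ 0 1 τ).1) t - gAt g φ γ t (tractor g φ γ 0 1 t).2.1 _ = _
    simp only [h1, h2, deriv_const, gAt_smul_left, zero_sub]
  have hα : alpha g γ 0 t = tractorMetric g φ γ t V V := rfl
  have hK : frenetK1 g γ t = tractorMetric g φ γ t V
      (-V - ((1 / 2) * tractorMetric g φ γ t V V) • (0, 0, u)) := rfl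
  rw [hK, hα]
  set c := (1 / 2) * tractorMetric g φ γ t V V with hc
  have hexp : tractorMetric g φ γ t V (-V - c • (0, 0, u)) =
      -tractorMetric g φ γ t V V - c * (V.1 * u) := by
    simp only [tractorMetric, gAt, Prod.fst_sub, Prod.snd_sub, Prod.fst_neg, Prod.snd_neg,
      Prod.smul_fst, Prod.smul_snd, smul_zero, sub_zero, smul_eq_mul, mul_zero,
      Matrix.mulVec_neg, dotProduct_neg]
    ring
  rw [hexp, hV1]
  linear_combination (-1 : ℝ) * hc + c * hu2

variable [IsManifold (𝓡 n) ∞ M]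

theorem isChartedCurve_chartAt (hIo : IsOpen I) (hγ : ContMDiffOn 𝓘(ℝ, ℝ) (𝓡 n) ∞ γ I) (x : M) :
    IsChartedCurve (chartAt (EuclideanSpace ℝ (Fin n)) x) γ
      (I ∩ γ ⁻¹' (chartAt (EuclideanSpace ℝ (Fin n)) x).source) where
  mem_atlas := chart_mem_atlas _ x
  isOpen := hγ.continuousOn.isOpen_inter_preimage hIo (chartAt _ x).open_source
  mem_source _ ht := ht.2
  smooth := contMDiffOn_iff_contDiffOn.1 <|
    (contMDiffOn_chart (I := 𝓡 n) (n := ∞) (x := x)).comp (hγ.mono Set.inter_subset_left)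
      fun _ ht => ht.2

/-- An `r`-null curve satisfies the orthogonality relations with respect to any parameter. -/
theorem IsRNull.reparam (hIo : IsOpen I) (hIc : I.OrdConnected)
    (hγ : ContMDiffOn 𝓘(ℝ, ℝ) (𝓡 n) ∞ γ I) (hR : IsRNull g γ r I) (hs : IsParameter I s)
    {t : ℝ} (ht : t ∈ I) :
    ∃ J', s t ∈ J' ∧
      IsChartedCurve (chartAt (EuclideanSpace ℝ (Fin n)) (γ t)) (reparam γ I s) J' ∧
      IsNullChain g (chartAt (EuclideanSpace ℝ (Fin n)) (γ t)) (reparam γ I s) r J' := by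
  set φ := chartAt (EuclideanSpace ℝ (Fin n)) (γ t) with hφ
  have h := isChartedCurve_chartAt hIo hγ (γ t)
  have hN : IsNullChain g φ γ r (I ∩ γ ⁻¹' φ.source) := h.isNullChain
    (fun τ hτ => (hR τ hτ.1 φ (chart_mem_atlas _ _) hτ.2).2.1)
    (fun τ hτ => (hR τ hτ.1 φ (chart_mem_atlas _ _) hτ.2).2.2)
  have hJ' : IsOpen (s '' (I ∩ γ ⁻¹' φ.source)) :=
    hs.isOpen_image hIo h.isOpen Set.inter_subset_left
  have hσ : ContDiffOn ℝ ∞ (Function.invFunOn s I) (s '' (I ∩ γ ⁻¹' φ.source)) := by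
    rintro _ ⟨τ, hτ, rfl⟩
    exact (hs.contDiffAt_invFunOn hIo hIc hτ.1).contDiffWithinAt
  have hm : Set.MapsTo (Function.invFunOn s I) (s '' (I ∩ γ ⁻¹' φ.source))
      (I ∩ γ ⁻¹' φ.source) := by
    rintro _ ⟨τ, hτ, rfl⟩
    rwa [hs.invFunOn_apply hIc hτ.1]
  refine ⟨s '' (I ∩ γ ⁻¹' φ.source), ⟨t, ⟨ht, mem_chart_source _ _⟩, rfl⟩, h.comp hJ' hσ hm,
    hN.comp h hJ' hσ hm ?_⟩
  rintro _ ⟨τ, hτ, rfl⟩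
  exact hs.deriv_invFunOn_ne_zero hIo hIc hτ.1

/-- With respect to any parameter, `ε = ±1` along an `r`-null curve. -/
theorem IsRNull.eps_reparam_ne_zero (hIo : IsOpen I) (hIc : I.OrdConnected)
    (hγ : ContMDiffOn 𝓘(ℝ, ℝ) (𝓡 n) ∞ γ I) (hR : IsRNull g γ r I) (hs : IsParameter I s)
    {t : ℝ} (ht : t ∈ I) : eps g (ConformalCurves.reparam γ I s) r (s t) ≠ 0 := by
  obtain ⟨J', hmem, h, hN⟩ := hR.reparam hIo hIc hγ hs ht
  have key := hN.tractorMetric_self h hmem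
  -- `eps` is read in the chart at the point of the reparametrized curve; that point is `γ t`, so
  -- the charts are identified.
  rw [← hs.reparam_apply (γ := γ) hIc ht] at key
  have hn := hN.nonnull _ hmem
  rw [← hs.reparam_apply (γ := γ) hIc ht] at hn
  rw [eps, gram, key]
  rcases lt_or_gt_of_ne hn with hlt | hgt
  · simp [sign_neg hlt]
  · simp [sign_pos hgt]

/-- A regular curve in positive definite signature is `0`-null. -/
theorem isRNull_zero_of_mfderiv_ne_zero {g : PseudoMetric n n 0 M} (hIo : IsOpen I)
    (hγ : ContMDiffOn 𝓘(ℝ, ℝ) (𝓡 n) ∞ γ I)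
    (hreg : ∀ t ∈ I, mfderiv 𝓘(ℝ, ℝ) (𝓡 n) γ t ≠ 0) : IsRNull g γ 0 I := by
  intro t ht φ hφ hsrc
  refine ⟨linearIndependent_empty_type, by simp, ne_of_gt ?_⟩
  -- If the components of the velocity in the chart vanished, so would the derivative of `φ ∘ γ`,
  -- and injectivity of the chart's differential would contradict regularity.
  refine dotProduct_gMat_mulVec_self_pos g hφ (φ.map_source hsrc) fun h0 => hreg t ht ?_
  have : IsManifold (𝓡 n) 1 M := IsManifold.of_le (n := ∞) (by exact_mod_cast le_top)
  have hmd := mdifferentiable_of_mem_atlas (I := 𝓡 n) hφ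
  have hγt : MDifferentiableAt 𝓘(ℝ, ℝ) (𝓡 n) γ t :=
    (hγ.contMDiffAt (hIo.mem_nhds ht)).mdifferentiableAt (by simp)
  have hcomp := mfderiv_comp t (hmd.mdifferentiableAt hsrc) hγt
  have hdiff : DifferentiableAt ℝ (φ ∘ γ) t :=
    mdifferentiableAt_iff_differentiableAt.1 ((hmd.mdifferentiableAt hsrc).comp t hγt)
  have hd : deriv (φ ∘ γ) t = 0 := by
    ext i
    have hi := ((EuclideanSpace.proj i : EuclideanSpace ℝ (Fin n) →L[ℝ] ℝ).hasFDerivAt.comp_hasDerivAt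
      t hdiff.hasDerivAt).deriv
    have h0i : deriv (fun τ => φ (γ τ) i) t = 0 := congrFun h0 i
    exact hi.symm.trans h0i
  have hf : mfderiv 𝓘(ℝ, ℝ) (𝓡 n) (φ ∘ γ) t = 0 := by
    rw [mfderiv_eq_fderiv]
    ext1
    exact hd
  have hinj := hmd.mfderiv_injective hsrc
  refine ContinuousLinearMap.ext fun v => hinj ?_
  have := congrArg (fun A => A v) (hcomp.symm.trans hf)
  exact this.trans (map_zero _).symm

end Curvature

end ConformalCurves

/-! ### The two equivalences. -/

theorem mainTheorem8 {n : ℕ} (hn : 3 ≤ n) (M : Type*) [TopologicalSpace M]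
    [ChartedSpace (EuclideanSpace ℝ (Fin n)) M] [IsManifold (𝓡 n) ∞ M]
    (I : Set ℝ) (hIo : IsOpen I) (hIc : I.OrdConnected)
    (γ : ℝ → M) (hγ : ContMDiffOn 𝓘(ℝ, ℝ) (𝓡 n) ∞ γ I) :
    (∀ (C : ConformalStructure n n 0 M), ∀ g ∈ C.scales,
      (∀ t ∈ I, mfderiv 𝓘(ℝ, ℝ) (𝓡 n) γ t ≠ 0) →
      (∀ t ∈ I, Phi g γ t ≠ 0) →
      ∀ s : ℝ → ℝ, IsArcLength g γ I s →
        (IsProjectiveParameter g γ 0 I s ↔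
          ∀ t ∈ I, frenetK1 g (reparam γ I s) (s t) = 0)) ∧
    (∀ (p q r : ℕ) (C : ConformalStructure n p q M), ∀ g ∈ C.scales,
      IsRNull g γ r I →
      (∀ t ∈ I, gramDet g γ r (2 * r + 4) t ≠ 0) →
      ∀ s : ℝ → ℝ, IsPseudoArcLength g γ r I s →
        (IsProjectiveParameter g γ r I s ↔
          ∀ t ∈ I, nullK1 g (reparam γ I s) r (s t) = 0)) := by
  constructor
  · intro C g _ hreg _ s hs
    have hR : IsRNull g γ 0 I := isRNull_zero_of_mfderiv_ne_zero hIo hγ hreg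
    have hK : ∀ t ∈ I, frenetK1 g (reparam γ I s) (s t) =
        -(1 / 2) * alpha g (reparam γ I s) 0 (s t) := by
      intro t ht
      obtain ⟨J', hmem, h, hN⟩ := hR.reparam hIo hIc hγ hs.1 ht
      rw [← hs.1.reparam_apply (γ := γ) hIc ht] at h hN
      -- For `r = 0` non-nullity concerns `U` itself, so the velocity with respect to `s` is nonzero
      -- and has positive norm.
      refine frenetK1_eq (dotProduct_gMat_mulVec_self_pos g (chart_mem_atlas _ _)
        (h.mem_target hmem) fun h0 => hN.nonnull _ hmem ?_)
      rw [derivedVec, h0, gAt_zero_left]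
    refine ⟨fun h t ht => by rw [hK t ht, h.2 t ht, mul_zero], fun h => ⟨hs.1, fun t ht => ?_⟩⟩
    simpa [hK t ht] using h t ht
  · intro p q r C g _ hR _ s hs
    refine ⟨fun h t ht => by rw [nullK1, h.2 t ht, mul_zero], fun h => ⟨hs.1, fun t ht => ?_⟩⟩
    -- Here `ε ≠ 0` is what allows `α = 0` to be read off from `-½εα = 0`.
    simpa [nullK1, hR.eps_reparam_ne_zero hIo hIc hγ hs.1 ht] using h t ht
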